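/- Let $L\in\mathbb{R}^{n\times n}$ be a symmetric positive semidefinite matrix and let $1\le k\le n$ be such that $\det(L_S)>0$ for at least one $k$-element subset $S\subseteq[n]$, where $L_S$ is the principal submatrix of $L$ indexed by $S$. The discrete $k$-DPP defined by $L$ is the probability distribution $\pi$ on $\Omega=\binom{[n]}{k}$ with $\pi(S)\propto\det(L_S)$. Its Gibbs sampler is the Markov chain $\mathcal{M}=(\Omega,P,\pi)$, reversible with respect to $\pi$, which moves from a state $x\in\Omega$ as follows: choose $i\in x$ uniformly at random, set $I=x\setminus\{i\}$, and move to $I\cup\{y\}$, where $y\in[n]\setminus I$ is chosen with probability proportional to $\det(L_{I\cup\{y\}})$ (so $y=i$ is possible). If all these determinants vanish, which can happen only when $\pi(x)=0$, the chain stays at $x$. For $S\subseteq\Omega$ put $Q(S,\overline S)=\sum_{x\in S,\,y\notin S}\pi(x)P(x,y)$, and define the conductance $$\phi(\mathcal{M})=\min_{S\subseteq\Omega,\;0<\pi(S)\le 1/2}\frac{Q(S,\overline S)}{\pi(S)},$$ where the minimum over the empty family is $+\infty$. Theorem. There is an absolute constant $C>0$ such that for all $n$, $k$ and $L$ as above,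 $$\phi(\mathcal{M})\ \ge\ \frac{1}{Ck^2}.$$ In particular, the bound does not depend on $n$ or on $L$. -/

import Mathlib

namespace KDPP

noncomputable section

/-- A time reversible Markov chain `(Ω, P, π)` on a finite state space. -/
structure ReversibleChain (Ω : Type*) [Fintype Ω] where
  /-- transition probabilities -/
  P : Ω → Ω → ℝ
  /-- stationary distribution -/
  π : Ω → ℝ
  P_nonneg : ∀ x y, 0 ≤ P x y
  P_sum : ∀ x, ∑ y, P x y = 1
  π_nonneg : ∀ x, 0 ≤ π x
  π_sum : ∑ x, π x = 1
  reversible : ∀ x y, π x * P x y = π y * P y x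

namespace ReversibleChain

variable {Ω : Type*} [Fintype Ω] [DecidableEq Ω]

/-- `π(S)`, the stationary probability of a set of states. -/
def prob (M : ReversibleChain Ω) (S : Finset Ω) : ℝ := ∑ x ∈ S, M.π x

/-- `Q(S, T) = ∑_{x ∈ S, y ∈ T} π(x) P(x, y)`. -/
def flow (M : ReversibleChain Ω) (S T : Finset Ω) : ℝ := ∑ x ∈ S, ∑ y ∈ T, M.π x * M.P x y

/-- The conductance: the minimum of `Q(S, Sᶜ) / π(S)` over all `S` with `0 < π(S) ≤ 1/2`.
It takes values in the extended reals, so that the minimum over the empty family is `+∞`. -/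
def conductance (M : ReversibleChain Ω) : EReal :=
  ⨅ S : Finset Ω, ⨅ _ : 0 < M.prob S ∧ M.prob S ≤ 1 / 2,
    ((M.flow S Sᶜ / M.prob S : ℝ) : EReal)

end ReversibleChain

variable {ι : Type*} [Fintype ι] [DecidableEq ι]

/-- `det(L_S)`, the principal minor of `L` indexed by the elements of `S`. -/
def principalMinor (L : Matrix ι ι ℝ) (S : Finset ι) : ℝ :=
  (L.submatrix (fun i : S => (i : ι)) (fun j : S => (j : ι))).det

/-- The `k`-element subsets of the ground set. -/
abbrev State (ι : Type*) (k : ℕ) : Type _ := {S : Finset ι // S.card = k}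

/-- The normalizing constant of the `k`-DPP: the sum of all `k × k` principal minors of `L`. -/
def partitionFn (L : Matrix ι ι ℝ) (k : ℕ) : ℝ := ∑ S : State ι k, principalMinor L S

/-- The `k`-DPP defined by `L`: the probability of a `k`-subset `S` is proportional to
`det(L_S)`. -/
def kdpp (L : Matrix ι ι ℝ) (k : ℕ) (S : State ι k) : ℝ := principalMinor L S / partitionFn L k

/-- The sum of `det(L_{I + y})` over all `y ∉ I`. -/
def condWeight (L : Matrix ι ι ℝ) (I : Finset ι) : ℝ := ∑ y ∈ Iᶜ, principalMinor L (insert y I)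

/-- The probability that `y ∉ I` is the point added to `I`, when `i` has just been removed:
proportional to `det(L_{I + y})`. If all of these weights vanish (which never happens when the
current state `I + i` has positive probability), the removed point `i` is put back. -/
def resample (L : Matrix ι ι ℝ) (I : Finset ι) (i y : ι) : ℝ :=
  if condWeight L I = 0 then (if y = i then 1 else 0) else principalMinor L (insert y I) / condWeight L I

/-- One step of the Gibbs sampler from `x` to `z`: a uniformly random point `i` of `x` is removed,
and a point `y` is drawn from the conditional distribution given `x - i` and added. -/
def gibbsP (L : Matrix ι ι ℝ) (k : ℕ) (x z : State ι k) : ℝ :=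
  ∑ i ∈ x.1, (1 / (k : ℝ)) *
    ∑ y ∈ (x.1.erase i)ᶜ, if insert y (x.1.erase i) = z.1 then resample L (x.1.erase i) i y else 0

theorem principalMinor_nonneg {L : Matrix ι ι ℝ} (hL : L.PosSemidef) (S : Finset ι) : 0 ≤ principalMinor L S :=
  (hL.submatrix _).det_nonneg

theorem condWeight_nonneg {L : Matrix ι ι ℝ} (hL : L.PosSemidef) (I : Finset ι) :
    0 ≤ condWeight L I :=
  Finset.sum_nonneg fun _ _ => principalMinor_nonneg hL _

theorem resample_nonneg {L : Matrix ι ι ℝ} (hL : L.PosSemidef) (I : Finset ι) (i y : ι) :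
    0 ≤ resample L I i y := by
  unfold resample
  split_ifs
  · exact zero_le_one
  · exact le_rfl
  · exact div_nonneg (principalMinor_nonneg hL _) (condWeight_nonneg hL _)

theorem resample_sum (L : Matrix ι ι ℝ) (I : Finset ι) (i : ι) (hi : i ∉ I) :
    ∑ y ∈ Iᶜ, resample L I i y = 1 := by
  unfold resample
  by_cases h : condWeight L I = 0
  · simp [h, hi]
  · simp only [h, if_false]
    rw [← Finset.sum_div]
    exact div_self h

theorem gibbsP_nonneg {L : Matrix ι ι ℝ} (hL : L.PosSemidef) (k : ℕ) (x z : State ι k) :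
    0 ≤ gibbsP L k x z := by
  unfold gibbsP
  refine Finset.sum_nonneg fun i _ => mul_nonneg (by positivity) (Finset.sum_nonneg fun y _ => ?_)
  split_ifs
  · exact resample_nonneg hL _ _ _
  · exact le_rfl

theorem gibbsP_sum (L : Matrix ι ι ℝ) {k : ℕ} (hk : 1 ≤ k) (x : State ι k) :
    ∑ z, gibbsP L k x z = 1 := by
  unfold gibbsP
  rw [Finset.sum_comm]
  have key : ∀ i ∈ x.1, ∑ z : State ι k, (1 / (k : ℝ)) *
      (∑ y ∈ (x.1.erase i)ᶜ,
        if insert y (x.1.erase i) = z.1 then resample L (x.1.erase i) i y else 0) = 1 / k := by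
    intro i hi
    rw [← Finset.mul_sum, Finset.sum_comm]
    have h2 : ∀ y ∈ (x.1.erase i)ᶜ, (∑ z : State ι k,
        if insert y (x.1.erase i) = z.1 then resample L (x.1.erase i) i y else 0)
        = resample L (x.1.erase i) i y := by
      intro y hy
      have hc : (insert y (x.1.erase i)).card = k := by
        rw [Finset.card_insert_of_notMem (Finset.mem_compl.1 hy), Finset.card_erase_of_mem hi, x.2]
        omega
      rw [Finset.sum_eq_single (⟨insert y (x.1.erase i), hc⟩ : State ι k)]
      · simp
      · intro z _ hz
        rw [if_neg]
        intro h
        exact hz (Subtype.ext h.symm)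
      · simp
    rw [Finset.sum_congr rfl h2, resample_sum L _ i (Finset.notMem_erase i _), mul_one]
  rw [Finset.sum_congr rfl key, Finset.sum_const, x.2, nsmul_eq_mul]
  have : (k : ℝ) ≠ 0 := by positivity
  field_simp

theorem principalMinor_mul_gibbsP {L : Matrix ι ι ℝ} (hL : L.PosSemidef) (k : ℕ) (x z : State ι k) :
    principalMinor L x * gibbsP L k x z = ∑ i ∈ x.1, ∑ y ∈ z.1,
      if x.1.erase i = z.1.erase y then
        (1 / (k : ℝ)) * (principalMinor L x * principalMinor L z / condWeight L (x.1.erase i)) else 0 := by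
  unfold gibbsP
  rw [Finset.mul_sum]
  refine Finset.sum_congr rfl fun i hi => ?_
  by_cases h : condWeight L (x.1.erase i) = 0
  · have hx : principalMinor L x.1 = 0 := by
      have h1 := (Finset.sum_eq_zero_iff_of_nonneg
        (fun y _ => principalMinor_nonneg hL (insert y (x.1.erase i)))).1 h i (by simp)
      rwa [Finset.insert_erase hi] at h1
    simp [hx]
  · rw [Finset.mul_sum, Finset.mul_sum]
    have hl : ∀ y, principalMinor L x * ((1 / (k : ℝ)) * if insert y (x.1.erase i) = z.1 then
          resample L (x.1.erase i) i y else 0)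
        = if insert y (x.1.erase i) = z.1 then
          (1 / (k : ℝ)) * (principalMinor L x * principalMinor L z / condWeight L (x.1.erase i)) else 0 := by
      intro y
      split_ifs with hy
      · rw [resample, if_neg h, hy]
        ring
      · simp
    simp only [hl]
    rw [← Finset.sum_filter, ← Finset.sum_filter]
    refine Finset.sum_congr ?_ fun _ _ => rfl
    ext y
    simp only [Finset.mem_filter, Finset.mem_compl]
    constructor
    · rintro ⟨hy, hyz⟩
      rw [← hyz]
      exact ⟨Finset.mem_insert_self _ _, (Finset.erase_insert hy).symm⟩
    · rintro ⟨hy, hyz⟩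
      rw [hyz]
      exact ⟨Finset.notMem_erase _ _, Finset.insert_erase hy⟩

theorem gibbsP_reversible {L : Matrix ι ι ℝ} (hL : L.PosSemidef) (k : ℕ) (x z : State ι k) :
    kdpp L k x * gibbsP L k x z = kdpp L k z * gibbsP L k z x := by
  unfold kdpp
  rw [div_mul_eq_mul_div, div_mul_eq_mul_div, principalMinor_mul_gibbsP hL, principalMinor_mul_gibbsP hL,
    Finset.sum_comm]
  congr 1
  refine Finset.sum_congr rfl fun i _ => Finset.sum_congr rfl fun y _ => ?_
  by_cases h : x.1.erase y = z.1.erase i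
  · rw [if_pos h, if_pos h.symm, h, mul_comm (principalMinor L x.1)]
  · rw [if_neg h, if_neg (Ne.symm h)]

/-- The Gibbs sampler for the `k`-DPP defined by the kernel `L`. -/
def gibbsSampler (L : Matrix ι ι ℝ) (hL : L.PosSemidef) (k : ℕ) (hk : 1 ≤ k)
    (hZ : 0 < partitionFn L k) : ReversibleChain (State ι k) where
  P := gibbsP L k
  π := kdpp L k
  P_nonneg := gibbsP_nonneg hL k
  P_sum := gibbsP_sum L hk
  π_nonneg x := div_nonneg (principalMinor_nonneg hL _) hZ.le
  π_sum := by
    unfold kdpp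
    rw [← Finset.sum_div]
    exact div_self hZ.ne'
  reversible := gibbsP_reversible hL k

end

end KDPP

/-!
The Gibbs sampler removes a uniformly random point and resamples it, so the flow out of a set of
states `S` is `1 / k` times the expected variance of the indicator `f` of `S` given the set `I` of
the `k - 1` points that are kept (`flow_gibbsSampler`, `stepVar_stateIndicator`). The proof shows
the Poincaré inequality `Var f ≤ 𝔼 Var (f | I)` (`variance_le_sum_stepVar`). It bounds the flow
below by `π(S) (1 - π(S)) / k`, and the conductance by `1 / (2 k)`, so that `C = 2` will do.

Reveal the points of a random state one by one, in random order. The variance of `f` is the sum of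
the `k` increments of variance of its conditional expectations, and the last increment is
`𝔼 Var (f | I)`. It is therefore enough that the increments grow from one point to the next
(`stepVar_succ_le`). Conditionally on the set `J` of points already seen, this compares the variance
of a symmetric function of a random pair of points with that of its conditional expectation given
one of them, and follows once the matrix of pair weights at `J` has at most one positive direction
(`HyperbolicAt`, `two_mul_sum_sq_div_le`).

If only two points are missing, the pair weights are `2 × 2` minors of a Schur complement of `L`,
and their quadratic form is `(tr A)² - tr A²` with `A` linear in the argument
(`hyperbolicAt_principalMinor_of_posDef`). Oppenheim's trickle-down argument carries hyperbolicity
from the sets `J ∪ {x}` to `J` (`HyperbolicAt.of_insert`). It uses that all weights are positive, as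
they are when `L` is positive definite, and a limit gives the semidefinite case
(`hyperbolicAt_linkSum_iterate`).

Weights are not normalized: iterating `linkSum` sums over ordered sequences of added points, and
the factorials appear only when the sums are evaluated at `∅` (`linkSum_iterate_empty`).
-/

namespace KDPP

/-! ### Quadratic forms of symmetric weights -/

section Abstract
variable {V : Type*} [Fintype V]

/-- A quadratic form `l² - r` with `r` positive semidefinite satisfies the reverse Cauchy–Schwarz
inequality against a vector at which it is nonnegative. Here `l₁`, `lₐ`, `r₁`, `rₐ` are the values
at two vectors and `r` is the polarization of the second form. -/
theorem reverse_cauchy_schwarz_of_sq_sub {l₁ lₐ r₁ rₐ r : ℝ} (h₁ : 0 ≤ r₁) (hₐ : 0 ≤ rₐ)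
    (hr : r ^ 2 ≤ rₐ * r₁) (hl : r₁ ≤ l₁ ^ 2) :
    (lₐ ^ 2 - rₐ) * (l₁ ^ 2 - r₁) ≤ (lₐ * l₁ - r) ^ 2 := by
  rcases h₁.eq_or_lt with h | h
  · subst h
    have : r = 0 := by nlinarith [sq_nonneg r]
    subst this
    nlinarith [mul_nonneg hₐ (sq_nonneg l₁)]
  · have key : 0 ≤ r₁ * ((lₐ * l₁ - r) ^ 2 - (lₐ ^ 2 - rₐ) * (l₁ ^ 2 - r₁)) := by
      have : r₁ * ((lₐ * l₁ - r) ^ 2 - (lₐ ^ 2 - rₐ) * (l₁ ^ 2 - r₁))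
          = (lₐ * r₁ - l₁ * r) ^ 2 + (l₁ ^ 2 - r₁) * (rₐ * r₁ - r ^ 2) := by ring
      rw [this]
      exact add_nonneg (sq_nonneg _) (mul_nonneg (sub_nonneg.2 hl) (sub_nonneg.2 hr))
    linarith [nonneg_of_mul_nonneg_right key h]

/-- The variance of a symmetric function `F / W` of a random pair is at least twice the variance
of its conditional expectation given one point of the pair, if the pair weights `W` are hyperbolic.
The function is compared with its projection onto sums of functions of one point each, and
hyperbolicity says that two such summands are not positively correlated. -/
theorem two_mul_sum_sq_div_le {W F : V → V → ℝ} (hW : ∀ y z, 0 ≤ W y z)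
    (hWs : ∀ y z, W y z = W z y) (hFs : ∀ y z, F y z = F z y)
    (hFW : ∀ y z, W y z = 0 → F y z = 0)
    (H : ∀ a : V → ℝ, (∑ y, ∑ z, W y z * (a y * a z)) * ∑ y, ∑ z, W y z
      ≤ (∑ y, (∑ z, W y z) * a y) ^ 2) :
    2 * ∑ y, (∑ z, F y z) ^ 2 / ∑ z, W y z
      ≤ ∑ y, ∑ z, F y z ^ 2 / W y z + (∑ y, ∑ z, F y z) ^ 2 / ∑ y, ∑ z, W y z := by
  set w : V → ℝ := fun y => ∑ z, W y z with hw
  set p : V → ℝ := fun y => ∑ z, F y z with hp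
  set w₀ := ∑ y, w y with hw₀
  set p₀ := ∑ y, p y with hp₀
  have hwn : ∀ y, 0 ≤ w y := fun y => Finset.sum_nonneg fun z _ => hW y z
  have hp0 : ∀ y, w y = 0 → p y = 0 := fun y h => Finset.sum_eq_zero fun z hz =>
    hFW y z ((Finset.sum_eq_zero_iff_of_nonneg fun z _ => hW y z).1 h z hz)
  have hp00 : w₀ = 0 → p₀ = 0 := fun h => Finset.sum_eq_zero fun y hy =>
    hp0 y ((Finset.sum_eq_zero_iff_of_nonneg fun y _ => hwn y).1 h y hy)
  set g : V → ℝ := fun y => p y / w y with hg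
  set c : ℝ := p₀ / w₀ with hc
  have hwg : ∀ y, w y * g y = p y := fun y => by
    by_cases h : w y = 0
    · simp [h, hp0 y h]
    · simp only [hg]; field_simp
  have hwc : w₀ * c = p₀ := by
    by_cases h : w₀ = 0
    · simp [h, hp00 h]
    · simp only [hc]; field_simp
  -- the pair function is compared with its projection onto sums `g y + g z - c`
  have h1 : ∑ y, ∑ z, (2 * F y z * (g y + g z - c) - W y z * (g y + g z - c) ^ 2)
      ≤ ∑ y, ∑ z, F y z ^ 2 / W y z := by
    refine Finset.sum_le_sum fun y _ => Finset.sum_le_sum fun z _ => ?_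
    rcases (hW y z).eq_or_lt with h | h
    · simp [← h, hFW y z h.symm]
    · rw [le_div_iff₀ h]
      nlinarith [sq_nonneg (F y z - W y z * (g y + g z - c))]
  have e1 : ∑ y, ∑ z, F y z * g y = ∑ y, p y * g y := by simp [hp, Finset.sum_mul]
  have e2 : ∑ y, ∑ z, F y z * g z = ∑ y, p y * g y := by
    rw [Finset.sum_comm, ← e1]; simp only [hFs]
  have e3 : ∑ y, ∑ z, W y z * g y = p₀ := by
    simp only [← Finset.sum_mul]
    exact Finset.sum_congr rfl fun y _ => hwg y
  have e4 : ∑ y, ∑ z, W y z * g z = p₀ := by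
    rw [Finset.sum_comm, ← e3]; simp only [hWs]
  have e5 : ∑ y, ∑ z, W y z * g y ^ 2 = ∑ y, p y * g y := by
    refine Finset.sum_congr rfl fun y _ => ?_
    rw [← Finset.sum_mul, ← hwg y]; ring
  have e6 : ∑ y, ∑ z, W y z * g z ^ 2 = ∑ y, p y * g y := by
    rw [Finset.sum_comm, ← e5]; simp only [hWs]
  have h2 : ∑ y, ∑ z, (2 * F y z * (g y + g z - c) - W y z * (g y + g z - c) ^ 2)
      = 2 * (∑ y, ∑ z, F y z * g y) + 2 * (∑ y, ∑ z, F y z * g z) - 2 * c * p₀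
        - (∑ y, ∑ z, W y z * g y ^ 2) - (∑ y, ∑ z, W y z * g z ^ 2) - c ^ 2 * w₀
        - 2 * (∑ y, ∑ z, W y z * (g y * g z)) + 2 * c * (∑ y, ∑ z, W y z * g y)
        + 2 * c * (∑ y, ∑ z, W y z * g z) := by
    simp only [hp₀, hw₀, hp, hw, Finset.mul_sum, ← Finset.sum_add_distrib,
      ← Finset.sum_sub_distrib]
    exact Finset.sum_congr rfl fun y _ => Finset.sum_congr rfl fun z _ => by ring
  have h3 : ∑ y, ∑ z, W y z * (g y * g z) ≤ c * p₀ := by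
    have := H g
    change _ * w₀ ≤ (∑ y, w y * g y) ^ 2 at this
    simp only [hwg] at this
    rcases (show 0 ≤ w₀ from Finset.sum_nonneg fun y _ => hwn y).eq_or_lt with h | h
    · have hz : ∀ y z, W y z = 0 := fun y z =>
        (Finset.sum_eq_zero_iff_of_nonneg fun z _ => hW y z).1
          ((Finset.sum_eq_zero_iff_of_nonneg fun y _ => hwn y).1 h.symm y (Finset.mem_univ _))
          z (Finset.mem_univ _)
      simp [hz, hp00 h.symm]
    · rw [hc, div_mul_eq_mul_div, le_div_iff₀ h, ← sq]
      exact this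
  have h4 : ∑ y, p y ^ 2 / w y = ∑ y, p y * g y :=
    Finset.sum_congr rfl fun y _ => by simp only [hg]; ring
  have h5 : p₀ ^ 2 / w₀ = c * p₀ := by rw [hc]; ring
  have h6 : c ^ 2 * w₀ = c * p₀ := by rw [← hwc]; ring
  change 2 * ∑ y, p y ^ 2 / w y ≤ _ + p₀ ^ 2 / w₀
  rw [h4, h5]
  rw [h2, e1, e2, e3, e4, e5, e6, h6] at h1
  linarith

/-- The spectral part of the trickle-down argument. With `D` the diagonal matrix of row sums of `W`,
the hypothesis `H` says that `M = D⁻¹ W` satisfies `M ≤ M²`, so that each of its eigenvalues in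
`(0, 1]` is `1`. By connectedness the eigenvalue `1` belongs to the constants only, whence `M` is
negative semidefinite on their orthogonal complement. -/
theorem sum_mul_sum_le_sq_of_trickle_down {W : V → V → ℝ} (hW : ∀ y z, 0 ≤ W y z)
    (hWs : ∀ y z, W y z = W z y)
    (hconn : ∀ y z, y ≠ z → 0 < ∑ x, W y x → 0 < ∑ x, W z x → 0 < W y z)
    (H : ∀ a : V → ℝ, ∑ y, ∑ z, W y z * (a y * a z)
      ≤ ∑ y, (∑ z, W y z * a z) ^ 2 / ∑ z, W y z) (a : V → ℝ) :
    (∑ y, ∑ z, W y z * (a y * a z)) * ∑ y, ∑ z, W y z ≤ (∑ y, (∑ z, W y z) * a y) ^ 2 := by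
  classical
  set w : V → ℝ := fun y => ∑ z, W y z with hw
  have hwn : ∀ y, 0 ≤ w y := fun y => Finset.sum_nonneg fun z _ => hW y z
  have hW0 : ∀ y z, w y = 0 → W y z = 0 := fun y z h =>
    (Finset.sum_eq_zero_iff_of_nonneg fun z _ => hW y z).1 h z (Finset.mem_univ _)
  have hW0' : ∀ y z, w z = 0 → W y z = 0 := fun y z h => by rw [hWs, hW0 z y h]
  set s : V → ℝ := fun y => √(w y) with hs
  have hss : ∀ y, s y * s y = w y := fun y => Real.mul_self_sqrt (hwn y)
  have hs0 : ∀ y, s y = 0 → w y = 0 := fun y h => by rw [← hss, h, zero_mul]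
  have hsW : ∀ y z, s y * (W y z / (s y * s z)) * s z = W y z := fun y z => by
    by_cases h : s y = 0
    · simp [h, hW0 y z (hs0 y h)]
    by_cases h' : s z = 0
    · simp [h', hW0' y z (hs0 z h')]
    field_simp
  -- the symmetric normalization of `W`
  set A : Matrix V V ℝ := Matrix.of fun y z => W y z / (s y * s z) with hA
  have hAh : A.IsHermitian := by
    ext y z
    simp [hA, hWs y z, mul_comm]
  set v := hAh.eigenvectorBasis with hv
  set lam := hAh.eigenvalues with hlam
  have hvA : ∀ i y, ∑ z, A y z * v i z = lam i * v i y := fun i y => by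
    have := congrFun (hAh.mulVec_eigenvectorBasis i) y
    simpa [Matrix.mulVec, dotProduct] using this
  have hvn : ∀ i, ∑ y, v i y * v i y = 1 := fun i => by
    have := v.orthonormal.1 i
    rw [EuclideanSpace.norm_eq, Real.sqrt_eq_one] at this
    simpa [sq] using this
  -- eigenvalues in `(0, ∞)` belong to multiples of `s`
  have hpos : ∀ i, 0 < lam i → ∃ c : ℝ, ∀ y, v i y = c * s y := by
    intro i hi
    set b : V → ℝ := fun y => v i y / s y with hb
    have hAb : ∀ y z, A y z * v i z = W y z * b z / s y := fun y z => by
      simp only [hA, hb, Matrix.of_apply]; field_simp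
    have q1 : ∀ y, ∑ z, W y z * b z = s y * (lam i * v i y) := fun y => by
      by_cases h : s y = 0
      · simp [h, hW0 y _ (hs0 y h)]
      rw [← hvA, Finset.mul_sum]
      refine Finset.sum_congr rfl fun z _ => ?_
      rw [hAb]; field_simp
    have hv0 : ∀ y, s y = 0 → v i y = 0 := fun y h => by
      have := hvA i y
      simp only [hA, Matrix.of_apply, h, zero_mul, div_zero, Finset.sum_const_zero] at this
      exact (mul_eq_zero.1 this.symm).resolve_left hi.ne'
    have hsb : ∀ y, v i y = b y * s y := fun y => by
      by_cases h : s y = 0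
      · simp [h, hv0 y h]
      simp only [hb]; field_simp
    have q2 : ∑ y, ∑ z, W y z * (b y * b z) = lam i := by
      rw [← mul_one (lam i), ← hvn i, Finset.mul_sum]
      refine Finset.sum_congr rfl fun y _ => ?_
      calc ∑ z, W y z * (b y * b z) = b y * ∑ z, W y z * b z := by
            rw [Finset.mul_sum]; exact Finset.sum_congr rfl fun z _ => by ring
        _ = lam i * (v i y * v i y) := by rw [q1, hsb]; ring
    have q3 : ∑ y, (∑ z, W y z * b z) ^ 2 / w y ≤ lam i ^ 2 := by
      rw [← mul_one (lam i ^ 2), ← hvn i, Finset.mul_sum]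
      refine (Finset.sum_congr rfl fun y _ => ?_).le
      rw [q1]
      by_cases h : s y = 0
      · simp [h, hv0 y h]
      rw [← hss]; field_simp
    have hge : 1 ≤ lam i := by
      have := (H b).trans q3
      rw [q2] at this
      nlinarith
    have q4 : ∑ y, ∑ z, W y z * (b y - b z) ^ 2 = 2 * 1 - 2 * lam i := by
      have t1 : ∑ y, ∑ z, W y z * b y ^ 2 = 1 := by
        rw [← hvn i]
        refine Finset.sum_congr rfl fun y _ => ?_
        rw [← Finset.sum_mul, hsb]
        change w y * _ = _
        rw [← hss]; ring
      have t2 : ∑ y, ∑ z, W y z * b z ^ 2 = 1 := by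
        rw [Finset.sum_comm, ← t1]; simp only [hWs]
      have : ∑ y, ∑ z, W y z * (b y - b z) ^ 2 = (∑ y, ∑ z, W y z * b y ^ 2)
          + (∑ y, ∑ z, W y z * b z ^ 2) - 2 * ∑ y, ∑ z, W y z * (b y * b z) := by
        simp only [Finset.mul_sum, ← Finset.sum_add_distrib, ← Finset.sum_sub_distrib]
        exact Finset.sum_congr rfl fun y _ => Finset.sum_congr rfl fun z _ => by ring
      rw [this, t1, t2, q2]; ring
    have hterm : ∀ y z, 0 ≤ W y z * (b y - b z) ^ 2 := fun y z =>
      mul_nonneg (hW y z) (sq_nonneg _)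
    have q5 : ∑ y, ∑ z, W y z * (b y - b z) ^ 2 = 0 :=
      le_antisymm (by linarith)
        (Finset.sum_nonneg fun y _ => Finset.sum_nonneg fun z _ => hterm y z)
    have q6 : ∀ y z, W y z * (b y - b z) ^ 2 = 0 := fun y z =>
      (Finset.sum_eq_zero_iff_of_nonneg fun z _ => hterm y z).1
        ((Finset.sum_eq_zero_iff_of_nonneg fun y _ => Finset.sum_nonneg fun z _ => hterm y z).1
          q5 y (Finset.mem_univ _)) z (Finset.mem_univ _)
    by_cases hex : ∃ x, 0 < w x
    · obtain ⟨x, hx⟩ := hex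
      refine ⟨b x, fun y => ?_⟩
      by_cases h : s y = 0
      · simp [h, hv0 y h]
      rw [hsb]
      congr 1
      by_cases hxy : y = x
      · rw [hxy]
      have hy : 0 < w y := (hwn y).lt_of_ne' fun h0 => h (by simp [hs, h0])
      have := (mul_eq_zero.1 (q6 y x)).resolve_left (hconn y x hxy hy hx).ne'
      linarith [pow_eq_zero_iff (two_ne_zero) |>.1 this]
    · refine ⟨0, fun y => ?_⟩
      rw [zero_mul, hv0 y]
      have : w y = 0 := le_antisymm (not_lt.1 fun h => hex ⟨y, h⟩) (hwn y)
      simp [hs, this]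
  -- on the orthogonal complement of `s` the form of `A` is nonpositive
  have hneg : ∀ g : V → ℝ, ∑ y, g y * s y = 0 → ∑ y, ∑ z, A y z * (g y * g z) ≤ 0 := by
    intro g hg
    set G : EuclideanSpace ℝ V := WithLp.toLp 2 g with hG
    set c : V → ℝ := fun i => ∑ y, v i y * g y with hcdef
    have hexp : ∀ y, g y = ∑ i, c i * v i y := fun y => by
      have := congrArg (fun u : EuclideanSpace ℝ V => u y) (v.sum_repr' G)
      simp only [hG] at this
      rw [← this]
      simp [hcdef, PiLp.inner_apply, mul_comm]
    have : ∑ y, ∑ z, A y z * (g y * g z) = ∑ i, lam i * c i ^ 2 := by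
      calc ∑ y, ∑ z, A y z * (g y * g z)
          = ∑ y, g y * ∑ z, A y z * g z := by
            refine Finset.sum_congr rfl fun y _ => ?_
            rw [Finset.mul_sum]; exact Finset.sum_congr rfl fun z _ => by ring
        _ = ∑ y, g y * ∑ i, c i * (lam i * v i y) := by
            refine Finset.sum_congr rfl fun y _ => ?_
            congr 1
            calc ∑ z, A y z * g z = ∑ z, ∑ i, A y z * (c i * v i z) :=
                  Finset.sum_congr rfl fun z _ => by rw [hexp z, Finset.mul_sum]
              _ = ∑ i, c i * (lam i * v i y) := by
                  rw [Finset.sum_comm]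
                  refine Finset.sum_congr rfl fun i _ => ?_
                  rw [← hvA, Finset.mul_sum]
                  exact Finset.sum_congr rfl fun z _ => by ring
        _ = ∑ i, lam i * c i ^ 2 := by
            simp only [Finset.mul_sum]
            rw [Finset.sum_comm]
            refine Finset.sum_congr rfl fun i _ => ?_
            calc ∑ y, g y * (c i * (lam i * v i y)) = lam i * c i * ∑ y, v i y * g y := by
                  rw [Finset.mul_sum]; exact Finset.sum_congr rfl fun y _ => by ring
              _ = lam i * c i ^ 2 := by rw [sq, ← mul_assoc]
    rw [this]
    refine Finset.sum_nonpos fun i _ => ?_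
    rcases le_or_gt (lam i) 0 with h | h
    · exact mul_nonpos_of_nonpos_of_nonneg h (sq_nonneg _)
    · obtain ⟨d, hd⟩ := hpos i h
      have : c i = 0 := by
        simp only [hcdef, hd]
        rw [← mul_zero d, ← hg, Finset.mul_sum]
        exact Finset.sum_congr rfl fun y _ => by ring
      simp [this]
  set w₀ := ∑ y, w y with hw₀
  set p := ∑ y, w y * a y with hp
  rcases (show 0 ≤ w₀ from Finset.sum_nonneg fun y _ => hwn y).eq_or_lt with h | h
  · change _ * w₀ ≤ _
    rw [← h, mul_zero]; positivity
  have h0 := hneg (fun y => s y * (a y - p / w₀)) (by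
    have : ∀ y, s y * (a y - p / w₀) * s y = w y * a y - w y * (p / w₀) := fun y => by
      rw [← hss]; ring
    simp only [this, Finset.sum_sub_distrib, ← Finset.sum_mul]
    rw [← hp, ← hw₀]; field_simp; ring)
  have h1 : ∑ y, ∑ z, A y z * (s y * (a y - p / w₀) * (s z * (a z - p / w₀)))
      = (∑ y, ∑ z, W y z * (a y * a z)) - p ^ 2 / w₀ := by
    have r1 : ∑ y, ∑ z, W y z * a y = p := by simp [← Finset.sum_mul, hp, hw]
    have r2 : ∑ y, ∑ z, W y z * a z = p := by
      rw [Finset.sum_comm, ← r1]; simp only [hWs]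
    have : ∑ y, ∑ z, A y z * (s y * (a y - p / w₀) * (s z * (a z - p / w₀)))
        = (∑ y, ∑ z, W y z * (a y * a z)) - p / w₀ * (∑ y, ∑ z, W y z * a y)
          - p / w₀ * (∑ y, ∑ z, W y z * a z) + (p / w₀) ^ 2 * w₀ := by
      simp only [hw₀, hw, Finset.mul_sum, ← Finset.sum_add_distrib, ← Finset.sum_sub_distrib]
      refine Finset.sum_congr rfl fun y _ => Finset.sum_congr rfl fun z _ => ?_
      simp only [hA, Matrix.of_apply]
      have := hsW y z
      linear_combination ((a y - p / w₀) * (a z - p / w₀)) * this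
    rw [this, r1, r2]; field_simp; ring
  rw [h1, sub_nonpos, le_div_iff₀ h] at h0
  exact h0

end Abstract

/-! ### Sums over extensions of a set and trickle-down -/

section Link
variable {ι : Type*} [DecidableEq ι]

/-- The value of `G` at the extension of `J` by two distinct further points `y` and `z`, and `0`
when there is no such extension. -/
def pairWeight (G : Finset ι → ℝ) (J : Finset ι) (y z : ι) : ℝ :=
  if y ∈ J then 0 else if z ∈ insert y J then 0 else G (insert z (insert y J))

theorem pairWeight_comm (G : Finset ι → ℝ) (J : Finset ι) (y z : ι) :
    pairWeight G J y z = pairWeight G J z y := by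
  unfold pairWeight
  rw [Finset.insert_comm]
  by_cases h : y = z
  · subst h; simp
  · simp only [Finset.mem_insert, h, Ne.symm h, false_or]
    split_ifs <;> rfl

theorem pairWeight_nonneg {G : Finset ι → ℝ} (hG : ∀ J, 0 ≤ G J) (J : Finset ι) (y z : ι) :
    0 ≤ pairWeight G J y z := by
  unfold pairWeight
  split_ifs
  exacts [le_rfl, le_rfl, hG _]

variable [Fintype ι]

/-- The sum of a set function over all one-point extensions of its argument. -/
def linkSum (G : Finset ι → ℝ) (J : Finset ι) : ℝ := ∑ y ∈ Jᶜ, G (insert y J)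

theorem linkSum_eq_sum_ite (G : Finset ι → ℝ) (J : Finset ι) :
    linkSum G J = ∑ y, if y ∈ J then 0 else G (insert y J) := by
  rw [linkSum, ← Finset.sum_subset (Finset.subset_univ Jᶜ) fun y _ hy => if_pos (by simpa using hy)]
  exact Finset.sum_congr rfl fun y hy => (if_neg (Finset.mem_compl.1 hy)).symm

theorem linkSum_mono {G G' : Finset ι → ℝ} {J : Finset ι}
    (h : ∀ y ∉ J, G (insert y J) ≤ G' (insert y J)) : linkSum G J ≤ linkSum G' J :=
  Finset.sum_le_sum fun y hy => h y (Finset.mem_compl.1 hy)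

theorem linkSum_iterate_nonneg {G : Finset ι → ℝ} (hG : ∀ J, 0 ≤ G J) (m : ℕ) (J : Finset ι) :
    0 ≤ linkSum^[m] G J := by
  induction m generalizing J with
  | zero => exact hG J
  | succ m ih =>
    rw [Function.iterate_succ_apply']
    exact Finset.sum_nonneg fun y _ => ih _

theorem linkSum_iterate_pos {G : Finset ι → ℝ} (hG : ∀ J, 0 < G J) (m : ℕ) (J : Finset ι)
    (h : J.card + m ≤ Fintype.card ι) : 0 < linkSum^[m] G J := by
  induction m generalizing J with
  | zero => exact hG J
  | succ m ih =>
    rw [Function.iterate_succ_apply']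
    refine Finset.sum_pos (fun y hy => ih _ ?_) ?_
    · rw [Finset.card_insert_of_notMem (Finset.mem_compl.1 hy)]; omega
    · rw [← Finset.card_pos, Finset.card_compl]; omega

theorem linkSum_iterate_mono {G G' : Finset ι → ℝ} {m : ℕ} {J : Finset ι}
    (h : ∀ S : Finset ι, S.card = J.card + m → G S ≤ G' S) :
    linkSum^[m] G J ≤ linkSum^[m] G' J := by
  induction m generalizing J with
  | zero => exact h J rfl
  | succ m ih =>
    rw [Function.iterate_succ_apply', Function.iterate_succ_apply']
    refine linkSum_mono fun y hy => ih fun S hS => h S ?_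
    rw [hS, Finset.card_insert_of_notMem hy]; omega

theorem linkSum_iterate_eq_zero {G G' : Finset ι → ℝ} (hG : ∀ J, 0 ≤ G J)
    (h : ∀ J, G J = 0 → G' J = 0) {m : ℕ} {J : Finset ι} (h0 : linkSum^[m] G J = 0) :
    linkSum^[m] G' J = 0 := by
  induction m generalizing J with
  | zero => exact h J h0
  | succ m ih =>
    rw [Function.iterate_succ_apply'] at h0 ⊢
    exact Finset.sum_eq_zero fun y hy => ih <|
      (Finset.sum_eq_zero_iff_of_nonneg fun y _ => linkSum_iterate_nonneg hG m _).1 h0 y hy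

theorem linkSum_sub (G G' : Finset ι → ℝ) :
    linkSum (fun J => G J - G' J) = fun J => linkSum G J - linkSum G' J := by
  funext J; simp [linkSum]

theorem linkSum_iterate_sub (G G' : Finset ι → ℝ) (m : ℕ) :
    linkSum^[m] (fun J => G J - G' J) = fun J => linkSum^[m] G J - linkSum^[m] G' J := by
  induction m with
  | zero => rfl
  | succ m ih =>
    rw [Function.iterate_succ_apply', ih, linkSum_sub]
    simp only [Function.iterate_succ_apply']

/-- Double counting of the pairs consisting of a set and one of its points. -/
theorem sum_powersetCard_sum_compl (K : Finset ι → Finset ι → ℝ) (j : ℕ) :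
    ∑ J ∈ Finset.powersetCard j Finset.univ, ∑ y ∈ Jᶜ, K J (insert y J)
      = ∑ S ∈ Finset.powersetCard (j + 1) Finset.univ, ∑ y ∈ S, K (S.erase y) S := by
  rw [Finset.sum_sigma', Finset.sum_sigma']
  refine Finset.sum_bij' (fun p _ => ⟨insert p.2 p.1, p.2⟩) (fun p _ => ⟨p.1.erase p.2, p.2⟩)
    ?_ ?_ ?_ ?_ ?_
  · rintro ⟨J, y⟩ h
    simp only [Finset.mem_sigma, Finset.mem_powersetCard_univ, Finset.mem_compl] at h ⊢
    exact ⟨by rw [Finset.card_insert_of_notMem h.2, h.1], Finset.mem_insert_self _ _⟩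
  · rintro ⟨S, y⟩ h
    simp only [Finset.mem_sigma, Finset.mem_powersetCard_univ, Finset.mem_compl] at h ⊢
    exact ⟨by rw [Finset.card_erase_of_mem h.2, h.1]; rfl, Finset.notMem_erase _ _⟩
  · rintro ⟨J, y⟩ h
    simp only [Finset.mem_sigma, Finset.mem_compl] at h
    simp [Finset.erase_insert h.2]
  · rintro ⟨S, y⟩ h
    simp only [Finset.mem_sigma] at h
    simp [Finset.insert_erase h.2]
  · rintro ⟨J, y⟩ h
    simp only [Finset.mem_sigma, Finset.mem_compl] at h
    simp [Finset.erase_insert h.2]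

theorem linkSum_iterate_empty (G : Finset ι → ℝ) (m : ℕ) :
    linkSum^[m] G ∅ = (m.factorial : ℝ) * ∑ S ∈ Finset.powersetCard m Finset.univ, G S := by
  induction m generalizing G with
  | zero => simp
  | succ m ih =>
    rw [Function.iterate_succ_apply, ih]
    simp only [linkSum]
    rw [sum_powersetCard_sum_compl (fun _ S => G S), Nat.factorial_succ]
    have : ∀ S ∈ Finset.powersetCard (m + 1) (Finset.univ : Finset ι),
        ∑ _y ∈ S, G S = (m + 1 : ℝ) * G S := fun S hS => by
      rw [Finset.sum_const, Finset.mem_powersetCard_univ.1 hS, nsmul_eq_mul]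
      push_cast; rfl
    rw [Finset.sum_congr rfl this, ← Finset.mul_sum]
    push_cast; ring

theorem sum_pairWeight (G : Finset ι → ℝ) (J : Finset ι) (y : ι) :
    ∑ z, pairWeight G J y z = if y ∈ J then 0 else linkSum G (insert y J) := by
  unfold pairWeight
  split_ifs
  · simp
  · rw [linkSum_eq_sum_ite]

theorem sum_sum_pairWeight (G : Finset ι → ℝ) (J : Finset ι) :
    ∑ y, ∑ z, pairWeight G J y z = linkSum (linkSum G) J := by
  simp only [sum_pairWeight]
  rw [linkSum_eq_sum_ite]

/-- Hyperbolicity of a set function `G` at `J`: the quadratic form of its pair weights at `J`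
has at most one positive direction, in the form of a reverse Cauchy–Schwarz inequality against
the constant vector. -/
def HyperbolicAt (G : Finset ι → ℝ) (J : Finset ι) : Prop :=
  ∀ a : ι → ℝ, (∑ y, ∑ z, pairWeight G J y z * (a y * a z)) * ∑ y, ∑ z, pairWeight G J y z
    ≤ (∑ y, (∑ z, pairWeight G J y z) * a y) ^ 2

/-- Oppenheim's trickle-down step: hyperbolicity at all one-point extensions of `J` gives
hyperbolicity at `J`. -/
theorem HyperbolicAt.of_insert {G : Finset ι → ℝ} {J : Finset ι} (hG : ∀ J, 0 ≤ G J)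
    (hpos : ∀ y z, y ∉ J → z ∉ insert y J → 0 < linkSum G (insert z (insert y J)))
    (h : ∀ x ∉ J, HyperbolicAt G (insert x J)) : HyperbolicAt (linkSum G) J := by
  have hTG : ∀ J, 0 ≤ linkSum G J := fun J => linkSum_iterate_nonneg hG 1 J
  refine sum_mul_sum_le_sq_of_trickle_down (pairWeight_nonneg hTG J) (pairWeight_comm _ J) ?_ ?_
  · intro y z hyz hy hz
    simp only [sum_pairWeight] at hy hz
    have hyJ : y ∉ J := fun h => by simp [h] at hy
    have hzJ : z ∉ J := fun h => by simp [h] at hz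
    have hzy : z ∉ insert y J := by simp [hzJ, Ne.symm hyz]
    unfold pairWeight
    rw [if_neg hyJ, if_neg hzy]
    exact hpos y z hyJ hzy
  · intro a
    -- the pair weights at `J` are the sums of those at the one-point extensions of `J`
    have e1 : ∀ y z, pairWeight (linkSum G) J y z
        = ∑ x, if x ∈ J then 0 else pairWeight G (insert x J) y z := by
      intro y z
      unfold pairWeight
      split_ifs with h1 h2
      · exact (Finset.sum_eq_zero fun x _ => by simp [h1]).symm
      · exact (Finset.sum_eq_zero fun x _ => by
          rw [if_pos (show z ∈ insert y (insert x J) by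
            rw [Finset.insert_comm]; exact Finset.mem_insert_of_mem h2)]; simp).symm
      · rw [linkSum_eq_sum_ite]
        refine Finset.sum_congr rfl fun x _ => ?_
        have hJ : insert x (insert z (insert y J)) = insert z (insert y (insert x J)) := by
          rw [Finset.insert_comm x z, Finset.insert_comm x y]
        rw [hJ]
        simp only [Finset.mem_insert, not_or] at h2 ⊢
        by_cases hx : x ∈ J
        · simp [hx]
        by_cases hxy : y = x
        · simp [hxy]
        by_cases hxz : z = x
        · simp [hxz]
        simp [hx, hxy, hxz, Ne.symm hxy, Ne.symm hxz, h1, h2]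
    have e2 : ∑ y, ∑ z, pairWeight (linkSum G) J y z * (a y * a z)
        = ∑ x, if x ∈ J then 0 else ∑ y, ∑ z, pairWeight G (insert x J) y z * (a y * a z) := by
      simp only [e1, Finset.sum_mul]
      rw [Finset.sum_congr rfl fun y _ => Finset.sum_comm, Finset.sum_comm]
      refine Finset.sum_congr rfl fun x _ => ?_
      split_ifs <;> simp
    rw [e2]
    refine Finset.sum_le_sum fun x _ => ?_
    split_ifs with hx
    · rw [Finset.sum_congr rfl fun z _ => show pairWeight (linkSum G) J x z = 0 by
        simp [pairWeight, hx]]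
      simp
    · have := h x hx a
      rw [sum_sum_pairWeight] at this
      have e3 : ∑ y, (∑ z, pairWeight G (insert x J) y z) * a y
          = ∑ z, pairWeight (linkSum G) J x z * a z := by
        refine Finset.sum_congr rfl fun z _ => ?_
        rw [sum_pairWeight, pairWeight, if_neg hx]
      have e4 : ∑ z, pairWeight (linkSum G) J x z = linkSum (linkSum G) (insert x J) := by
        rw [sum_pairWeight, if_neg hx]
      rw [e3] at this
      rw [e4]
      rcases (linkSum_iterate_nonneg hG 2 (insert x J)).eq_or_lt with h0 | h0
      · change 0 = linkSum (linkSum G) (insert x J) at h0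
        rw [← h0, div_zero]
        refine Finset.sum_nonpos fun y _ => Finset.sum_nonpos fun z _ => ?_
        have hz : ∀ y z, pairWeight G (insert x J) y z = 0 := by
          rw [← sum_sum_pairWeight] at h0
          intro y z
          have hn := pairWeight_nonneg hG (insert x J)
          exact (Finset.sum_eq_zero_iff_of_nonneg fun z _ => hn y z).1
            ((Finset.sum_eq_zero_iff_of_nonneg fun y _ => Finset.sum_nonneg fun z _ => hn y z).1
              h0.symm y (Finset.mem_univ _)) z (Finset.mem_univ _)
        rw [hz, zero_mul]
      · exact (le_div_iff₀ h0).2 this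

end Link

/-! ### Hyperbolicity of principal minors -/

section Minors
variable {ι : Type*} [DecidableEq ι]

theorem principalMinor_eq_det_submatrix (L : Matrix ι ι ℝ) {κ : Type*} [Fintype κ] [DecidableEq κ]
    {S : Finset ι} (f : κ → ι) (hf : Function.Injective f) (hS : ∀ i, i ∈ S ↔ ∃ x, f x = i) :
    principalMinor L S = (L.submatrix f f).det := by
  let e : κ ≃ S := Equiv.ofBijective (fun x => ⟨f x, (hS _).2 ⟨x, rfl⟩⟩)
    ⟨fun x y h => hf (congrArg Subtype.val h), fun i => by
      obtain ⟨x, hx⟩ := (hS i).1 i.2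
      exact ⟨x, Subtype.ext hx⟩⟩
  rw [principalMinor, ← Matrix.det_submatrix_equiv_self e, Matrix.submatrix_submatrix]
  rfl

theorem principalMinor_pos {L : Matrix ι ι ℝ} (hL : L.PosDef) (S : Finset ι) :
    0 < principalMinor L S :=
  (hL.submatrix Subtype.val_injective).det_pos

/-- The Schur complement in `L` of the principal block indexed by `J`, as a matrix on the whole
index set; the rows and columns indexed by `J` vanish when the block is invertible. -/
noncomputable def schurCompl (L : Matrix ι ι ℝ) (J : Finset ι) : Matrix ι ι ℝ :=
  L - (L.submatrix id (fun j : J => (j : ι))) *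
    (L.submatrix (fun i : J => (i : ι)) (fun j : J => (j : ι)))⁻¹ *
      (L.submatrix (fun j : J => (j : ι)) id)

theorem posSemidef_schurCompl [Fintype ι] {L : Matrix ι ι ℝ} (hL : L.PosDef) (J : Finset ι) :
    (schurCompl L J).PosSemidef := by
  set c : J → ι := fun i => (i : ι) with hc
  have hA : (L.submatrix c c).PosDef := hL.submatrix Subtype.val_injective
  have := hA.isUnit.invertible
  have hT : (L.submatrix c id).conjTranspose = L.submatrix id c := by
    rw [Matrix.conjTranspose_submatrix, hL.isHermitian.eq]
  have h := hL.posSemidef.submatrix (Sum.elim c id)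
  have hb : L.submatrix (Sum.elim c id) (Sum.elim c id)
      = Matrix.fromBlocks (L.submatrix c c) (L.submatrix c id) (L.submatrix c id).conjTranspose L := by
    rw [hT]
    ext (i | i) (j | j) <;> rfl
  rw [hb, Matrix.PosDef.fromBlocks₁₁ _ _ hA, hT] at h
  exact h

theorem principalMinor_insert_insert {L : Matrix ι ι ℝ} (hL : L.PosDef) {J : Finset ι} {y z : ι}
    (hy : y ∉ J) (hz : z ∉ insert y J) :
    principalMinor L (insert z (insert y J)) = principalMinor L J *
      (schurCompl L J y y * schurCompl L J z z - schurCompl L J y z * schurCompl L J z y) := by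
  set c : J → ι := fun i => (i : ι) with hc
  have hA : (L.submatrix c c).PosDef := hL.submatrix Subtype.val_injective
  have := hA.isUnit.invertible
  simp only [Finset.mem_insert, not_or] at hz
  rw [principalMinor_eq_det_submatrix L (Sum.elim c ![y, z])]
  · have hb : L.submatrix (Sum.elim c ![y, z]) (Sum.elim c ![y, z])
        = Matrix.fromBlocks (L.submatrix c c) (L.submatrix c ![y, z]) (L.submatrix ![y, z] c)
          (L.submatrix ![y, z] ![y, z]) := by
      ext (i | i) (j | j) <;> rfl
    have hS : L.submatrix ![y, z] ![y, z]
        - L.submatrix ![y, z] c * ⅟(L.submatrix c c) * L.submatrix c ![y, z]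
        = (schurCompl L J).submatrix ![y, z] ![y, z] := by
      rw [Matrix.invOf_eq_nonsing_inv]
      rfl
    rw [hb, Matrix.det_fromBlocks₁₁, hS, Matrix.det_fin_two]
    rfl
  · rw [Sum.elim_injective]
    refine ⟨Subtype.val_injective, ?_, ?_⟩
    · intro i j h
      fin_cases i <;> fin_cases j <;> simp_all
    · intro i j h
      fin_cases j
      · exact hy ((show (i : ι) = y from h) ▸ i.2)
      · exact hz.2 ((show (i : ι) = z from h) ▸ i.2)
  · intro i
    simp only [Finset.mem_insert, Sum.exists, Sum.elim_inl, Sum.elim_inr, Fin.exists_fin_two,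
      Matrix.cons_val_zero, Matrix.cons_val_one, hc, Subtype.exists, exists_prop, exists_eq_right]
    constructor
    · rintro (h | h | h)
      exacts [Or.inr (Or.inr h.symm), Or.inr (Or.inl h.symm), Or.inl h]
    · rintro (h | h | h)
      exacts [Or.inr (Or.inr h), Or.inr (Or.inl h.symm), Or.inl h.symm]

variable [Fintype ι]

/-- For determinants the quadratic form of the pair weights is `(tr A)² - tr A²` with
`A = ∑ y, a y • v y (v y)ᵀ`, where the Schur complement is the Gram matrix of the vectors `v y`.
It is the square of a linear form minus a positive semidefinite form. -/
theorem hyperbolicAt_principalMinor_of_posDef {L : Matrix ι ι ℝ} (hL : L.PosDef) (J : Finset ι) :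
    HyperbolicAt (principalMinor L) J := by
  intro a
  set d := principalMinor L J with hd
  have hd0 : 0 < d := principalMinor_pos hL J
  set B := schurCompl L J with hB
  have hBp : B.PosSemidef := posSemidef_schurCompl hL J
  have hBs : ∀ y z, B z y = B y z := fun y z => by simpa using hBp.isHermitian.apply y z
  set χ : ι → ℝ := fun y => if y ∈ J then 0 else 1 with hχ
  have hW : ∀ y z, pairWeight (principalMinor L) J y z
      = d * (χ y * χ z * (B y y * B z z - B y z ^ 2)) := by
    intro y z
    unfold pairWeight
    split_ifs with h1 h2
    · simp [hχ, h1]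
    · rcases Finset.mem_insert.1 h2 with h2 | h2
      · subst h2; ring
      · simp [hχ, h2]
    · rw [principalMinor_insert_insert hL h1 h2]
      rw [Finset.mem_insert, not_or] at h2
      simp only [hχ, if_neg h1, if_neg h2.2]
      rw [← hd, ← hB, hBs y z]; ring
  -- the linear form and the positive semidefinite form
  set l : (ι → ℝ) → ℝ := fun u => ∑ y, B y y * u y with hl
  set R : (ι → ℝ) → (ι → ℝ) → ℝ := fun u v => ∑ y, ∑ z, B y z ^ 2 * (u y * v z) with hR
  have hRn : ∀ u, 0 ≤ R u u := fun u => by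
    have := (hBp.hadamard hBp).dotProduct_mulVec_nonneg u
    simp only [dotProduct, Matrix.mulVec, Matrix.hadamard_apply, Pi.star_apply, star_trivial,
      Finset.mul_sum] at this
    refine this.trans_eq (Finset.sum_congr rfl fun y _ => Finset.sum_congr rfl fun z _ => ?_)
    ring
  have hRsymm : ∀ u v, R u v = R v u := fun u v => by
    simp only [hR]
    rw [Finset.sum_comm]
    refine Finset.sum_congr rfl fun y _ => Finset.sum_congr rfl fun z _ => ?_
    rw [hBs y z]; ring
  have hRcs : ∀ u v, R u v ^ 2 ≤ R u u * R v v := fun u v => by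
    have h : ∀ t : ℝ, 0 ≤ R v v * (t * t) + (2 * R u v) * t + R u u := fun t => by
      have := hRn fun y => u y + t * v y
      have e : R (fun y => u y + t * v y) (fun y => u y + t * v y)
          = R u u + t * R u v + t * R v u + t * t * R v v := by
        simp only [hR, Finset.mul_sum, ← Finset.sum_add_distrib]
        exact Finset.sum_congr rfl fun y _ => Finset.sum_congr rfl fun z _ => by ring
      rw [e, hRsymm v u] at this
      linarith
    have := discrim_le_zero h
    rw [discrim] at this
    linarith
  have hQ : ∀ u v : ι → ℝ, ∑ y, ∑ z, pairWeight (principalMinor L) J y z * (u y * v z)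
      = d * (l (fun y => χ y * u y) * l (fun y => χ y * v y)
        - R (fun y => χ y * u y) (fun y => χ y * v y)) := fun u v => by
    simp only [hl, hR, Finset.sum_mul_sum, ← Finset.sum_sub_distrib, hW]
    simp only [Finset.mul_sum]
    exact Finset.sum_congr rfl fun y _ => Finset.sum_congr rfl fun z _ => by ring
  have h11 := hQ (fun _ => 1) (fun _ => 1)
  have haa := hQ a a
  have ha1 := hQ a (fun _ => 1)
  simp only [mul_one] at h11 ha1
  have ha1' : ∑ y, (∑ z, pairWeight (principalMinor L) J y z) * a y
      = ∑ y, ∑ z, pairWeight (principalMinor L) J y z * a y := by simp [Finset.sum_mul]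
  rw [haa, h11, ha1', ha1]
  have hnn : 0 ≤ l χ * l χ - R χ χ := by
    have h0 : 0 ≤ ∑ y, ∑ z, pairWeight (principalMinor L) J y z :=
      Finset.sum_nonneg fun y _ => Finset.sum_nonneg fun z _ =>
        pairWeight_nonneg (fun S => (principalMinor_pos hL S).le) J y z
    rw [h11] at h0
    exact nonneg_of_mul_nonneg_right h0 hd0
  have := reverse_cauchy_schwarz_of_sq_sub (l₁ := l χ) (lₐ := l fun y => χ y * a y) (hRn χ)
    (hRn fun y => χ y * a y) (hRcs _ _) (by linarith [sq (l χ)])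
  have := mul_le_mul_of_nonneg_left this (sq_nonneg d)
  linear_combination this

theorem hyperbolicAt_linkSum_iterate_of_posDef {L : Matrix ι ι ℝ} (hL : L.PosDef) (m : ℕ)
    (J : Finset ι) (h : J.card + m + 2 ≤ Fintype.card ι) :
    HyperbolicAt (linkSum^[m] (principalMinor L)) J := by
  induction m generalizing J with
  | zero => exact hyperbolicAt_principalMinor_of_posDef hL J
  | succ m ih =>
    rw [Function.iterate_succ_apply']
    refine HyperbolicAt.of_insert
      (linkSum_iterate_nonneg (fun S => (principalMinor_pos hL S).le) m) ?_ ?_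
    · intro y z hy hz
      rw [← Function.iterate_succ_apply' linkSum]
      refine linkSum_iterate_pos (principalMinor_pos hL) _ _ ?_
      rw [Finset.card_insert_of_notMem hz, Finset.card_insert_of_notMem hy]
      omega
    · intro x hx
      refine ih _ ?_
      rw [Finset.card_insert_of_notMem hx]
      omega

/-- The positive semidefinite case follows from the positive definite one, applied to `L + ε`,
as `ε` tends to zero. -/
theorem hyperbolicAt_linkSum_iterate {L : Matrix ι ι ℝ} (hL : L.PosSemidef) (m : ℕ)
    (J : Finset ι) (h : J.card + m + 2 ≤ Fintype.card ι) :
    HyperbolicAt (linkSum^[m] (principalMinor L)) J := by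
  intro a
  set Lε : ℝ → Matrix ι ι ℝ := fun ε => L + ε • (1 : Matrix ι ι ℝ) with hLε
  have hμ : ∀ S, Continuous fun ε => principalMinor (Lε ε) S := fun S => by
    unfold principalMinor
    refine Continuous.matrix_det (Continuous.matrix_submatrix ?_ _ _)
    fun_prop
  have hW : ∀ m S, Continuous fun ε => linkSum^[m] (principalMinor (Lε ε)) S := fun m => by
    induction m with
    | zero => exact hμ
    | succ m ih =>
      intro S
      simp only [Function.iterate_succ_apply', linkSum]
      exact continuous_finsetSum _ fun y _ => ih _
  have hP : ∀ y z, Continuous fun ε => pairWeight (linkSum^[m] (principalMinor (Lε ε))) J y z :=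
    fun y z => by
      unfold pairWeight
      split_ifs
      exacts [continuous_const, continuous_const, hW m _]
  have hL0 : Lε 0 = L := by simp [hLε]
  rw [← hL0]
  refine ContinuousWithinAt.closure_le (s := Set.Ioi (0 : ℝ)) (by simp)
    (f := fun ε => (∑ y, ∑ z, pairWeight (linkSum^[m] (principalMinor (Lε ε))) J y z
        * (a y * a z)) * ∑ y, ∑ z, pairWeight (linkSum^[m] (principalMinor (Lε ε))) J y z)
    (g := fun ε => (∑ y, (∑ z, pairWeight (linkSum^[m] (principalMinor (Lε ε))) J y z)
        * a y) ^ 2) ?_ ?_ ?_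
  · exact Continuous.continuousWithinAt (by fun_prop)
  · exact Continuous.continuousWithinAt (by fun_prop)
  · intro ε hε
    exact hyperbolicAt_linkSum_iterate_of_posDef
      (Matrix.PosDef.posSemidef_add hL (Matrix.PosDef.one.smul hε)) m J h a

end Minors

/-! ### Variance and the Poincaré inequality -/

section Gap
variable {ι : Type*} [Fintype ι] [DecidableEq ι]

/-- With `m` points still to be added to `J`, the squared conditional expectation of `f` given `J`
times the total weight of `J`, for the weights `μ`. -/
noncomputable def condSq (μ f : Finset ι → ℝ) (m : ℕ) (J : Finset ι) : ℝ :=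
  (linkSum^[m] (fun S => μ S * f S) J) ^ 2 / linkSum^[m] μ J

/-- With `m + 1` points still to be added to `J`, the weighted variance of the conditional
expectation of `f` when the next point is revealed. -/
noncomputable def stepVar (μ f : Finset ι → ℝ) (m : ℕ) (J : Finset ι) : ℝ :=
  linkSum (condSq μ f m) J - condSq μ f (m + 1) J

/-- Hyperbolicity makes the increments of variance grow from one revealed point to the next. -/
theorem stepVar_succ_le {μ : Finset ι → ℝ} (hμ : ∀ S, 0 ≤ μ S) (f : Finset ι → ℝ) {m : ℕ}
    {J : Finset ι} (H : HyperbolicAt (linkSum^[m] μ) J) :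
    stepVar μ f (m + 1) J ≤ linkSum (stepVar μ f m) J := by
  set W := linkSum^[m] μ with hW
  set F := linkSum^[m] (fun S => μ S * f S) with hF
  have hWn : ∀ S, 0 ≤ W S := linkSum_iterate_nonneg hμ m
  have key := two_mul_sum_sq_div_le (W := pairWeight W J) (F := pairWeight F J)
    (pairWeight_nonneg hWn J) (pairWeight_comm W J) (pairWeight_comm F J) (by
      intro y z h
      unfold pairWeight at h ⊢
      split_ifs with h1 h2
      · rfl
      · rfl
      · rw [if_neg h1, if_neg h2] at h
        exact linkSum_iterate_eq_zero hμ (fun S hS => by simp [hS]) h) H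
  rw [sum_sum_pairWeight, sum_sum_pairWeight] at key
  have e1 : ∑ y, (∑ z, pairWeight F J y z) ^ 2 / ∑ z, pairWeight W J y z
      = linkSum (condSq μ f (m + 1)) J := by
    rw [linkSum_eq_sum_ite]
    refine Finset.sum_congr rfl fun y _ => ?_
    rw [sum_pairWeight, sum_pairWeight]
    split_ifs
    · simp
    · simp only [condSq, Function.iterate_succ_apply', hW, hF]
  have e2 : ∑ y, ∑ z, pairWeight F J y z ^ 2 / pairWeight W J y z
      = linkSum (linkSum (condSq μ f m)) J := by
    rw [← sum_sum_pairWeight]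
    refine Finset.sum_congr rfl fun y _ => Finset.sum_congr rfl fun z _ => ?_
    unfold pairWeight
    split_ifs
    · simp
    · simp
    · simp only [condSq, hW, hF]
  have e3 : linkSum (linkSum F) J ^ 2 / linkSum (linkSum W) J = condSq μ f (m + 2) J := by
    simp only [condSq, Function.iterate_succ_apply', hW, hF]
  rw [e1, e2, e3] at key
  have e4 : linkSum (stepVar μ f m) J
      = linkSum (linkSum (condSq μ f m)) J - linkSum (condSq μ f (m + 1)) J :=
    congrFun (linkSum_sub (linkSum (condSq μ f m)) (condSq μ f (m + 1))) J
  rw [e4, stepVar]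
  linarith

theorem linkSum_iterate_stepVar_le {μ : Finset ι → ℝ} (hμ : ∀ S, 0 ≤ μ S) (f : Finset ι → ℝ)
    {n : ℕ} (H : ∀ m J, J.card + m + 2 ≤ n → HyperbolicAt (linkSum^[m] μ) J) (m j : ℕ)
    (J : Finset ι) (h : J.card + j + m + 1 ≤ n) :
    linkSum^[j] (stepVar μ f m) J ≤ linkSum^[j + m] (stepVar μ f 0) J := by
  induction m generalizing j with
  | zero => exact le_rfl
  | succ m ih =>
    refine (linkSum_iterate_mono (G' := linkSum (stepVar μ f m)) fun S hS =>
      stepVar_succ_le hμ f (H m S (by omega))).trans ?_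
    rw [← Function.iterate_succ_apply]
    refine (ih (j + 1) (by omega)).trans_eq ?_
    rw [show j + 1 + m = j + (m + 1) by ring]

theorem linkSum_iterate_condSq_sub_le {μ : Finset ι → ℝ} (hμ : ∀ S, 0 ≤ μ S) (f : Finset ι → ℝ)
    {n : ℕ} (H : ∀ m J, J.card + m + 2 ≤ n → HyperbolicAt (linkSum^[m] μ) J) (m j : ℕ)
    (J : Finset ι) (h : J.card + j + m + 1 ≤ n) :
    linkSum^[j + (m + 1)] (condSq μ f 0) J - linkSum^[j] (condSq μ f (m + 1)) J
      ≤ (m + 1 : ℝ) * linkSum^[j + m] (stepVar μ f 0) J := by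
  have hstep : ∀ m, linkSum^[j] (stepVar μ f m) J
      = linkSum^[j + 1] (condSq μ f m) J - linkSum^[j] (condSq μ f (m + 1)) J := fun m => by
    rw [Function.iterate_succ_apply]
    exact congrFun (linkSum_iterate_sub (linkSum (condSq μ f m)) (condSq μ f (m + 1)) j) J
  induction m generalizing j with
  | zero => simp [hstep]
  | succ m ih =>
    have h1 := ih (j + 1) (by omega) fun m => by
      rw [Function.iterate_succ_apply]
      exact congrFun (linkSum_iterate_sub (linkSum (condSq μ f m)) (condSq μ f (m + 1)) (j + 1)) J
    have h2 := linkSum_iterate_stepVar_le hμ f H (m + 1) j J (by omega)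
    rw [hstep] at h2
    rw [show j + 1 + (m + 1) = j + (m + 1 + 1) by ring,
      show j + 1 + m = j + (m + 1) by ring] at h1
    push_cast
    linarith

/-- The Poincaré inequality of the Gibbs sampler, without normalization: the variance of `f` is at
most the sum over all `I` with one point missing of the variance of `f` given `I`. -/
theorem variance_le_sum_stepVar {μ : Finset ι → ℝ} (hμ : ∀ S, 0 ≤ μ S) (f : Finset ι → ℝ)
    {m : ℕ} (H : ∀ i J, J.card + i + 2 ≤ m + 1 → HyperbolicAt (linkSum^[i] μ) J) :
    (∑ S ∈ Finset.powersetCard (m + 1) Finset.univ, condSq μ f 0 S)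
      - (∑ S ∈ Finset.powersetCard (m + 1) Finset.univ, μ S * f S) ^ 2
        / ∑ S ∈ Finset.powersetCard (m + 1) Finset.univ, μ S
      ≤ ∑ I ∈ Finset.powersetCard m Finset.univ, stepVar μ f 0 I := by
  have h := linkSum_iterate_condSq_sub_le hμ f H m 0 ∅ (by simp)
  simp only [Nat.zero_add, Function.iterate_zero, id_eq] at h
  rw [linkSum_iterate_empty, linkSum_iterate_empty, condSq, linkSum_iterate_empty,
    linkSum_iterate_empty] at h
  have hf : (0 : ℝ) < (m + 1).factorial := by positivity
  have hf' : ((m + 1).factorial : ℝ) = (m + 1) * m.factorial := by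
    rw [Nat.factorial_succ]; push_cast; ring
  refine le_of_mul_le_mul_left ?_ hf
  refine (h.trans' (le_of_eq ?_)).trans_eq ?_
  · rw [mul_sub]
    congr 1
    rw [mul_pow, sq ((m + 1).factorial : ℝ), mul_assoc, mul_div_mul_left _ _ hf.ne', mul_div_assoc]
  · rw [hf']; ring

end Gap

/-! ### The flow of the Gibbs sampler -/

section Conductance
variable {ι : Type*}

theorem sum_state [Fintype ι] (k : ℕ) (g : Finset ι → ℝ) :
    ∑ x : State ι k, g x.1 = ∑ x ∈ Finset.powersetCard k Finset.univ, g x :=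
  (Finset.sum_subtype _ (fun _ => Finset.mem_powersetCard_univ) g).symm

variable [DecidableEq ι]

/-- The indicator function of a family of states, as a function on all finite sets. -/
noncomputable def stateIndicator {k : ℕ} (S : Finset (State ι k)) (x : Finset ι) : ℝ :=
  if x ∈ S.map (Function.Embedding.subtype _) then 1 else 0

theorem stateIndicator_coe {k : ℕ} (S : Finset (State ι k)) (x : State ι k) :
    stateIndicator S x.1 = if x ∈ S then 1 else 0 := by
  unfold stateIndicator
  congr 1
  simp [x.2]

variable [Fintype ι]

theorem sum_mem_state {k : ℕ} (S : Finset (State ι k)) (g : Finset ι → ℝ) :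
    ∑ x ∈ S, g x.1 = ∑ x ∈ Finset.powersetCard k Finset.univ, stateIndicator S x * g x := by
  rw [← sum_state k fun x => stateIndicator S x * g x]
  simp [stateIndicator_coe]

theorem sum_compl_state {k : ℕ} (S : Finset (State ι k)) (g : Finset ι → ℝ) :
    ∑ x ∈ Sᶜ, g x.1
      = ∑ x ∈ Finset.powersetCard k Finset.univ, (1 - stateIndicator S x) * g x := by
  have h := Finset.sum_add_sum_compl S fun x => g x.1
  rw [sum_mem_state, sum_state] at h
  simp only [sub_mul, one_mul, Finset.sum_sub_distrib]
  linarith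

/-- Both `x ∈ S` and `z ∉ S` of a transition are extensions of the same set `I`. -/
theorem flow_gibbsSampler {L : Matrix ι ι ℝ} (hL : L.PosSemidef) {m : ℕ} (hk : 1 ≤ m + 1)
    (hZ : 0 < partitionFn L (m + 1)) (S : Finset (State ι (m + 1))) :
    (gibbsSampler L hL (m + 1) hk hZ).flow S Sᶜ
      = 1 / ((m + 1) * partitionFn L (m + 1)) * ∑ I ∈ Finset.powersetCard m Finset.univ,
        linkSum (fun x => principalMinor L x * stateIndicator S x) I
          * linkSum (fun x => principalMinor L x * (1 - stateIndicator S x)) I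
          / linkSum (principalMinor L) I := by
  set μ := principalMinor L with hμ
  set f := stateIndicator S with hf
  set Z := partitionFn L (m + 1) with hZdef
  have h1 : ∀ x z : State ι (m + 1), kdpp L (m + 1) x * gibbsP L (m + 1) x z
      = 1 / ((m + 1) * Z) * ∑ i ∈ x.1, ∑ y ∈ z.1,
        if x.1.erase i = z.1.erase y then μ x * μ z / linkSum μ (x.1.erase i) else 0 := by
    intro x z
    rw [kdpp, div_mul_eq_mul_div, principalMinor_mul_gibbsP hL, Finset.mul_sum, Finset.sum_div]
    refine Finset.sum_congr rfl fun i _ => ?_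
    rw [Finset.mul_sum, Finset.sum_div]
    refine Finset.sum_congr rfl fun y _ => ?_
    split_ifs
    · change 1 / ((m + 1 : ℕ) : ℝ) * (μ x * μ z / linkSum μ (x.1.erase i)) / Z = _
      push_cast
      field_simp
    · simp
  have h2 : (gibbsSampler L hL (m + 1) hk hZ).flow S Sᶜ
      = 1 / ((m + 1) * Z) * ∑ x ∈ S, ∑ z ∈ Sᶜ, ∑ i ∈ x.1, ∑ y ∈ z.1,
        if x.1.erase i = z.1.erase y then μ x * μ z / linkSum μ (x.1.erase i) else 0 := by
    simp only [ReversibleChain.flow, gibbsSampler, h1, ← Finset.mul_sum]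
  rw [h2]
  congr 1
  rw [sum_mem_state S fun x => ∑ z ∈ Sᶜ, ∑ i ∈ x, ∑ y ∈ z.1,
    if x.erase i = z.1.erase y then μ x * μ z / linkSum μ (x.erase i) else 0]
  have h3 : ∀ x : Finset ι, f x * ∑ z ∈ Sᶜ, ∑ i ∈ x, ∑ y ∈ z.1,
        (if x.erase i = z.1.erase y then μ x * μ z / linkSum μ (x.erase i) else 0)
      = ∑ i ∈ x, ∑ z ∈ Finset.powersetCard (m + 1) Finset.univ, ∑ y ∈ z,
        if x.erase i = z.erase y then
          (μ x * f x) * (μ z * (1 - f z)) / linkSum μ (x.erase i) else 0 := by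
    intro x
    rw [sum_compl_state S fun z => ∑ i ∈ x, ∑ y ∈ z,
      if x.erase i = z.erase y then μ x * μ z / linkSum μ (x.erase i) else 0]
    simp only [Finset.mul_sum]
    rw [Finset.sum_comm]
    refine Finset.sum_congr rfl fun i _ => Finset.sum_congr rfl fun z _ =>
      Finset.sum_congr rfl fun y _ => ?_
    split_ifs
    · ring
    · simp
  rw [Finset.sum_congr rfl fun x _ => h3 x]
  rw [← sum_powersetCard_sum_compl fun I x => ∑ z ∈ Finset.powersetCard (m + 1) Finset.univ,
    ∑ y ∈ z, if I = z.erase y then (μ x * f x) * (μ z * (1 - f z)) / linkSum μ I else 0]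
  refine Finset.sum_congr rfl fun I hI => ?_
  simp only [linkSum, Finset.sum_mul, Finset.sum_div]
  refine Finset.sum_congr rfl fun i _ => ?_
  rw [← sum_powersetCard_sum_compl fun I' z => if I = I' then
    (μ (insert i I) * f (insert i I)) * (μ z * (1 - f z)) / ∑ y ∈ Iᶜ, μ (insert y I) else 0]
  rw [Finset.sum_eq_single_of_mem I hI fun I' _ hne =>
    Finset.sum_eq_zero fun y _ => if_neg hne.symm]
  simp only [if_true, Finset.mul_sum, Finset.sum_div]

theorem condSq_stateIndicator (μ : Finset ι → ℝ) {k : ℕ} (S : Finset (State ι k))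
    (x : Finset ι) : condSq μ (stateIndicator S) 0 x = μ x * stateIndicator S x := by
  simp only [condSq, Function.iterate_zero, id_eq, stateIndicator]
  rcases eq_or_ne (μ x) 0 with h | h
  · simp [h]
  · split_ifs
    · field_simp
    · simp

theorem stepVar_stateIndicator {μ : Finset ι → ℝ} (hμ : ∀ S, 0 ≤ μ S) {k : ℕ}
    (S : Finset (State ι k)) (I : Finset ι) :
    stepVar μ (stateIndicator S) 0 I = linkSum (fun x => μ x * stateIndicator S x) I
      * linkSum (fun x => μ x * (1 - stateIndicator S x)) I / linkSum μ I := by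
  set f := stateIndicator S with hf
  have h1 : condSq μ f 0 = fun x => μ x * f x := funext (condSq_stateIndicator μ S)
  have h2 : linkSum (fun x => μ x * (1 - f x)) I
      = linkSum μ I - linkSum (fun x => μ x * f x) I := by
    rw [← congrFun (linkSum_sub μ fun x => μ x * f x) I]
    simp only [mul_sub, mul_one]
  have h0 : linkSum μ I = 0 → linkSum (fun x => μ x * f x) I = 0 := fun h =>
    linkSum_iterate_eq_zero (G' := fun x => μ x * f x) (m := 1) hμ (fun x hx => by simp [hx]) h
  rw [stepVar, h1, h2]
  simp only [condSq, Function.iterate_succ_apply', Function.iterate_zero, id_eq]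
  rcases eq_or_ne (linkSum μ I) 0 with h | h
  · simp [h, h0 h]
  · field_simp

/-- The conductance bound before division: the flow out of `S` is at least `π(S) (1 - π(S)) / k`. -/
theorem prob_mul_le_flow {L : Matrix ι ι ℝ} (hL : L.PosSemidef) {m : ℕ} (hk : 1 ≤ m + 1)
    (hZ : 0 < partitionFn L (m + 1)) (S : Finset (State ι (m + 1))) :
    (gibbsSampler L hL (m + 1) hk hZ).prob S * (1 - (gibbsSampler L hL (m + 1) hk hZ).prob S)
      / (m + 1) ≤ (gibbsSampler L hL (m + 1) hk hZ).flow S Sᶜ := by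
  set μ := principalMinor L with hμ
  set f := stateIndicator S with hf
  set Z := partitionFn L (m + 1) with hZdef
  have hμn : ∀ S, 0 ≤ μ S := principalMinor_nonneg hL
  have hZsum : ∑ x ∈ Finset.powersetCard (m + 1) Finset.univ, μ x = Z :=
    (sum_state (m + 1) μ).symm
  -- there are states, because their weights have a positive sum
  have hcard : m + 1 ≤ Fintype.card ι := by
    by_contra h
    rw [Finset.powersetCard_eq_empty.2 (by rw [Finset.card_univ]; omega),
      Finset.sum_empty] at hZsum
    exact hZ.ne hZsum
  have hvar := variance_le_sum_stepVar hμn f (m := m) fun i J h =>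
    hyperbolicAt_linkSum_iterate hL i J (h.trans hcard)
  have hp : (gibbsSampler L hL (m + 1) hk hZ).prob S
      = (∑ x ∈ Finset.powersetCard (m + 1) Finset.univ, μ x * f x) / Z := by
    simp only [ReversibleChain.prob, gibbsSampler, kdpp]
    rw [← Finset.sum_div, sum_mem_state S μ]
    simp only [mul_comm (μ _)]
    rfl
  rw [flow_gibbsSampler, hp]
  rw [Finset.sum_congr rfl fun x _ => condSq_stateIndicator μ S x, hZsum,
    Finset.sum_congr rfl fun I _ => stepVar_stateIndicator hμn S I] at hvar
  refine le_trans (le_of_eq ?_) (mul_le_mul_of_nonneg_left hvar (by positivity))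
  rw [← hZdef, ← hf]
  field_simp

end Conductance

end KDPP

theorem mainTheorem1 :
    ∃ C : ℝ, 0 < C ∧
      ∀ (n k : ℕ) (hk : 1 ≤ k) (L : Matrix (Fin n) (Fin n) ℝ) (hL : L.PosSemidef)
        (hZ : 0 < KDPP.partitionFn L k),
        ((1 / (C * (k : ℝ) ^ 2) : ℝ) : EReal) ≤
          (KDPP.gibbsSampler L hL k hk hZ).conductance := by
  refine ⟨2, two_pos, fun n k hk L hL hZ => ?_⟩
  obtain ⟨m, rfl⟩ : ∃ m, k = m + 1 := ⟨k - 1, by omega⟩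
  refine le_iInf₂ fun S hS => EReal.coe_le_coe_iff.2 ?_
  rw [le_div_iff₀ hS.1]
  refine le_trans ?_ (KDPP.prob_mul_le_flow hL hk hZ S)
  obtain ⟨h0, h1⟩ := hS
  set p := (KDPP.gibbsSampler L hL (m + 1) hk hZ).prob S
  push_cast
  have hm : (1 : ℝ) ≤ m + 1 := by linarith [(Nat.cast_nonneg m : (0 : ℝ) ≤ m)]
  have h2 : 1 / (2 * ((m : ℝ) + 1) ^ 2) ≤ 1 / (2 * ((m : ℝ) + 1)) :=
    one_div_le_one_div_of_le (by positivity) (by nlinarith)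
  calc 1 / (2 * ((m : ℝ) + 1) ^ 2) * p ≤ 1 / (2 * ((m : ℝ) + 1)) * p :=
        mul_le_mul_of_nonneg_right h2 h0.le
    _ = p * (1 / 2) / (m + 1) := by field_simp
    _ ≤ p * (1 - p) / (m + 1) := by gcongr; linarith
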